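/- Let $G$ be a nice group, that is, a finite group which is either a cyclic $p$-group for some prime $p$, or a generalized quaternion group $Q_{4n}=\langle a,b : a^n=b^2,\ a^{2n}=1,\ b^{-1}ab=a^{-1}\rangle$ with $n\ge 2$ whose order is a power of $2$. For a $G$-space $X$, let the mapping index $\operatorname{ind} X$ be the least $k\ge 0$ for which there is a continuous $G$-equivariant map $X\to E_kG$, where $E_kG=G^{*(k+1)}$ is the $(k+1)$-fold join of the discrete space $G$ with $G$ acting by left translation ($\operatorname{ind}X=\infty$ if there is no such $k$). If $\mathcal K_1,\mathcal K_2$ are free $G$-simplicial complexes (simplicial complexes with a simplicial $G$-action that is free on the geometric realization) with $\operatorname{ind}\mathcal K_1=\operatorname{ind}\mathcal K_2=1$, then $\operatorname{ind}(\mathcal K_1\times\mathcal K_2)=1$, where $\mathcal K_1\times\mathcal K_2$ is the product of the geometric realizations with the diagonal $G$-action. In particular, the statement $\mathsf{HCT}_1(G)$ is true, where $\mathsf{HCT}_n(G)$ says: for all finite free $G$-simplicial complexes $\mathcal K_1,\mathcal K_2$, if $\operatorname{ind}\mathcal K_1=\operatorname{ind}\mathcal K_2=n$, then $\operatorname{ind}(\mathcal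 K_1\times\mathcal K_2)=n$. -/

import Mathlib

universe u v w

noncomputable section

/-- A finite group is *nice* if it is a cyclic `p`-group for some prime `p`, or a generalized
quaternion group `Q_{4n}`, `n ≥ 2`, whose order is a power of `2`. -/
def IsNiceGroup (G : Type u) [Group G] : Prop :=
  Finite G ∧
    ((IsCyclic G ∧ ∃ p : ℕ, p.Prime ∧ IsPGroup p G) ∨
      ((∃ n : ℕ, 2 ≤ n ∧ Nonempty (G ≃* QuaternionGroup n)) ∧ ∃ m : ℕ, Nat.card G = 2 ^ m))

/-- A `G`-simplicial complex with vertex set `V`: an abstract simplicial complex together with an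
action of `G` on the vertices that sends faces to faces. -/
structure GSimplicialComplex (G : Type u) [Group G] (V : Type v) [MulAction G V] extends
    AbstractSimplicialComplex V where
  smul_mem : ∀ (g : G) (s : Finset V), s ∈ faces → s.map (MulAction.toPerm g).toEmbedding ∈ faces

namespace GSimplicialComplex

section Realization

variable {G : Type u} [Group G] {V : Type v} [MulAction G V]

/-- The geometric realization, in barycentric coordinates: nonnegative weights on the vertices
which vanish outside some face and have total sum `1`. -/
@[ext]
structure Realization (K : GSimplicialComplex G V) where
  weight : V → ℝ
  nonneg : ∀ v, 0 ≤ weight v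
  exists_face : ∃ s ∈ K.faces, (∀ v, v ∉ s → weight v = 0) ∧ ∑ v ∈ s, weight v = 1

variable (K : GSimplicialComplex G V)

open Classical in
/-- The inclusion of the closed simplex spanned by a face `s` into the realization
(extension of the barycentric coordinates by zero). -/
def simplexMap (s : K.faces) (t : stdSimplex ℝ (s : Finset V)) : K.Realization where
  weight v := if h : v ∈ (s : Finset V) then t.1 ⟨v, h⟩ else 0
  nonneg v := by
    split_ifs with h
    · exact t.2.1 _
    · exact le_rfl
  exists_face := by
    refine ⟨s, s.2, fun v hv => dif_neg hv, ?_⟩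
    rw [← Finset.sum_coe_sort]
    simpa using t.2.2

/-- The usual (weak, or coherent) topology of the realization: a set is open if and only if its
trace on every closed simplex is open. For a finite complex this is the topology
induced from `ℝ^V`. -/
instance : TopologicalSpace K.Realization :=
  ⨆ s : K.faces, TopologicalSpace.coinduced (K.simplexMap s) inferInstance

/-- The action of `G` on the realization that extends the action on the vertices linearly over
each simplex: the weight of `v` in `x` becomes the weight of `g • v` in `g • x`. -/
instance : MulAction G K.Realization where
  smul g x :=
    { weight := fun v => x.weight (g⁻¹ • v)
      nonneg := fun v => x.nonneg _
      exists_face := by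
        obtain ⟨s, hs, h0, h1⟩ := x.exists_face
        refine ⟨_, K.smul_mem g s hs, fun v hv => h0 _ fun h => hv ?_, ?_⟩
        · exact Finset.mem_map.2 ⟨g⁻¹ • v, h, by simp⟩
        · simpa using h1 }
  one_smul x := by
    apply Realization.ext
    funext v
    change x.weight ((1 : G)⁻¹ • v) = x.weight v
    simp
  mul_smul g h x := by
    apply Realization.ext
    funext v
    change x.weight ((g * h)⁻¹ • v) = x.weight (h⁻¹ • g⁻¹ • v)
    rw [mul_inv_rev, mul_smul]

/-- A `G`-simplicial complex is free if `G` acts freely on its geometric realization. -/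
def IsFree : Prop :=
  ∀ (g : G) (x : K.Realization), g • x = x → g = 1

end Realization

end GSimplicialComplex

/-- The vertices of the `(k+1)`-fold join of `G`: `k + 1` disjoint copies of `G`. -/
@[ext]
structure JoinVertex (G : Type u) (k : ℕ) where
  elt : G
  level : Fin (k + 1)

/-- `G` acts on each of its copies by left translation. -/
instance (G : Type u) [Group G] (k : ℕ) : MulAction G (JoinVertex G k) where
  smul g x := ⟨g * x.elt, x.level⟩
  one_smul x := JoinVertex.ext (one_mul x.elt) rfl
  mul_smul g h x := JoinVertex.ext (mul_assoc g h x.elt) rfl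

/-- The `(k+1)`-fold join `G^{*(k+1)}` of the discrete `G`-space `G`, as a simplicial complex: the
faces are the nonempty finite sets of vertices with at most one vertex in each copy of `G`. -/
def joinComplex (G : Type u) [Group G] (k : ℕ) : GSimplicialComplex G (JoinVertex G k) where
  faces := {s | s.Nonempty ∧ ∀ x ∈ s, ∀ y ∈ s, x.level = y.level → x = y}
  isRelLowerSet_faces := fun _ hs =>
    ⟨hs.1, fun _ hts ht => ⟨ht, fun x hx y hy => hs.2 x (hts hx) y (hts hy)⟩⟩
  singleton_mem x := by
    refine ⟨Finset.singleton_nonempty x, fun y hy z hz _ => ?_⟩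
    rw [Finset.mem_singleton.1 hy, Finset.mem_singleton.1 hz]
  smul_mem g s hs := by
    refine ⟨hs.1.map, fun x hx y hy hxy => ?_⟩
    obtain ⟨x', hx', rfl⟩ := Finset.mem_map.1 hx
    obtain ⟨y', hy', rfl⟩ := Finset.mem_map.1 hy
    rw [hs.2 x' hx' y' hy' hxy]

/-- The space `E_k G = G^{*(k+1)}`. -/
abbrev EG (G : Type u) [Group G] (k : ℕ) : Type u := (joinComplex G k).Realization

/-- The mapping index of a `G`-space `X`: the least `k` for which there is a continuous
`G`-equivariant map `X → E_k G` (and `⊤` if there is no such `k`). -/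
def mappingIndex (G : Type u) [Group G] (X : Type v) [TopologicalSpace X] [MulAction G X] : ℕ∞ :=
  sInf {n : ℕ∞ | ∃ k : ℕ, n = k ∧ ∃ f : X →[G] EG G k, Continuous f}

/-- The statement `HCT_n(G)`. The product of two realizations carries the product
topology and the diagonal action. -/
def HCT (G : Type u) [Group G] (n : ℕ) : Prop :=
  ∀ (V₁ : Type v) (V₂ : Type w) [Finite V₁] [Finite V₂] [MulAction G V₁] [MulAction G V₂]
    (K₁ : GSimplicialComplex G V₁) (K₂ : GSimplicialComplex G V₂),
    K₁.IsFree → K₂.IsFree →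
    mappingIndex G K₁.Realization = n → mappingIndex G K₂.Realization = n →
    mappingIndex G (K₁.Realization × K₂.Realization) = n

end

/-! A continuous map to the discrete space `E_0 G = G` sees only connected components, so a
`G`-space with open components has index `0` exactly when `G` acts freely on its set of components.
If neither factor of a product has index `0`, each has a component with nontrivial stabilizer. In a
nice group these two stabilizers share a nontrivial element (in a cyclic `p`-group disjoint
subgroups have coprime orders; in a generalized quaternion `2`-group the only involution lies in
every nontrivial subgroup), and that element fixes a component of the product. Projecting to a
factor gives the upper bound. -/

section Subgroups

variable {G : Type*} [Group G]

theorem coprime_card_of_disjoint_of_isCyclic [Finite G] [IsCyclic G] {H K : Subgroup G}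
    (h : Disjoint H K) : (Nat.card H).Coprime (Nat.card K) := by
  let φ : H × K →* G := H.subtype.noncommCoprod K.subtype fun x y => mul_comm' (x : G) y
  have hφ : Function.Injective φ := (MonoidHom.noncommCoprod_injective _ _ _).2
    ⟨H.subtype_injective, K.subtype_injective, by simpa only [Subgroup.range_subtype] using h⟩
  have : IsCyclic (H × K) := isCyclic_of_injective φ hφ
  exact coprime_card_of_isCyclic_prod H K

theorem eq_bot_or_eq_bot_of_disjoint_of_isCyclic [Finite G] [IsCyclic G] {p : ℕ} (hp : p.Prime)
    (hG : IsPGroup p G) {H K : Subgroup G} (h : Disjoint H K) : H = ⊥ ∨ K = ⊥ := by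
  have : Fact p.Prime := ⟨hp⟩
  rcases (hG.to_subgroup H).card_eq_or_dvd with hH | hH
  · exact .inl (Subgroup.card_eq_one.1 hH)
  rcases (hG.to_subgroup K).card_eq_or_dvd with hK | hK
  · exact .inr (Subgroup.card_eq_one.1 hK)
  exact absurd (coprime_card_of_disjoint_of_isCyclic h)
    (Nat.not_coprime_of_dvd_of_dvd hp.one_lt hH hK)

theorem exists_mem_orderOf_eq_of_isPGroup {p : ℕ} (hp : p.Prime) (hG : IsPGroup p G)
    {H : Subgroup G} (hH : H ≠ ⊥) : ∃ x ∈ H, orderOf x = p := by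
  have : Fact p.Prime := ⟨hp⟩
  obtain ⟨g, hgH, hg⟩ := H.bot_or_exists_ne_one.resolve_left hH
  have hg0 : orderOf g ≠ 0 := (hG.isOfFinOrder hp.ne_zero g).orderOf_pos.ne'
  exact ⟨g ^ (orderOf g / p), H.pow_mem hgH _, orderOf_pow_orderOf_div hg0 (hG.dvd_orderOf hg)⟩

theorem eq_bot_or_eq_bot_of_disjoint_of_orderOf_eq_unique {p : ℕ} (hp : p.Prime)
    (hG : IsPGroup p G) (hunique : ∀ x y : G, orderOf x = p → orderOf y = p → x = y)
    {H K : Subgroup G} (h : Disjoint H K) : H = ⊥ ∨ K = ⊥ := by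
  by_contra! hHK
  obtain ⟨x, hxH, hx⟩ := exists_mem_orderOf_eq_of_isPGroup hp hG hHK.1
  obtain ⟨y, hyK, hy⟩ := exists_mem_orderOf_eq_of_isPGroup hp hG hHK.2
  obtain rfl := hunique x y hx hy
  rw [Subgroup.disjoint_def.1 h hxH hyK, orderOf_one] at hx
  exact hp.one_lt.ne hx

theorem quaternionGroup_eq_a_of_orderOf_eq_two {n : ℕ} [NeZero n] {x : QuaternionGroup n}
    (hx : orderOf x = 2) : x = QuaternionGroup.a n := by
  cases x with
  | xa i => simp [QuaternionGroup.orderOf_xa] at hx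
  | a i =>
    have hsq : QuaternionGroup.a i * QuaternionGroup.a i = 1 := by
      rw [← sq, ← hx, pow_orderOf_eq_one]
    have hi : -i = i := by
      rw [QuaternionGroup.a_mul_a, QuaternionGroup.one_def, QuaternionGroup.a.injEq] at hsq
      exact neg_eq_of_add_eq_zero_left hsq
    rcases (ZMod.neg_eq_self_iff i).1 hi with rfl | hval
    · simp [QuaternionGroup.a_zero] at hx
    · rw [← ZMod.natCast_zmod_val i, Nat.eq_of_mul_eq_mul_left two_pos hval]

theorem IsNiceGroup.eq_bot_or_eq_bot_of_disjoint (hG : IsNiceGroup G) {H K : Subgroup G}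
    (h : Disjoint H K) : H = ⊥ ∨ K = ⊥ := by
  obtain ⟨_, ⟨_, p, hp, hpG⟩ | ⟨⟨n, hn, ⟨e⟩⟩, m, hm⟩⟩ := hG
  · exact eq_bot_or_eq_bot_of_disjoint_of_isCyclic hp hpG h
  · have : NeZero n := ⟨by omega⟩
    have map_eq_a {z : G} (hz : orderOf z = 2) : e z = QuaternionGroup.a n :=
      quaternionGroup_eq_a_of_orderOf_eq_two ((e.orderOf_eq z).trans hz)
    exact eq_bot_or_eq_bot_of_disjoint_of_orderOf_eq_unique Nat.prime_two (.of_card hm)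
      (fun x y hx hy => e.injective ((map_eq_a hx).trans (map_eq_a hy).symm)) h

end Subgroups

theorem nonempty_mulActionHom_of_isCancelSMul {G X : Type*} [Group G] [MulAction G X]
    [IsCancelSMul G X] : Nonempty (X →[G] G) := by
  let rep (x : X) : X := (Quotient.mk (MulAction.orbitRel G X) x).out
  have rep_smul (g : G) (x : X) : rep (g • x) = rep x :=
    congrArg Quotient.out (Quotient.sound (MulAction.mem_orbit x g))
  have exists_smul_rep (x : X) : ∃ g : G, g • rep x = x :=
    (MulAction.orbitRel G X).symm (Quotient.mk_out x)
  choose f hf using exists_smul_rep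
  refine ⟨⟨f, fun g x => IsCancelSMul.right_cancel _ _ (rep x) ?_⟩⟩
  rw [smul_eq_mul, mul_smul, hf, id, ← rep_smul g, hf]

section Components

variable {G X Y : Type*} [Group G] [TopologicalSpace X] [TopologicalSpace Y] [MulAction G X]
  [MulAction G Y] [ContinuousConstSMul G X] [ContinuousConstSMul G Y]

/-- The action on the set `π₀` of connected components induced by an action by homeomorphisms. -/
instance : MulAction G (ConnectedComponents X) where
  smul g := (continuous_const_smul g : Continuous fun x : X => g • x).connectedComponentsMap
  one_smul := ConnectedComponents.surjective_coe.forall.2 fun x => congrArg _ (one_smul G x)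
  mul_smul g h := ConnectedComponents.surjective_coe.forall.2 fun x => congrArg _ (mul_smul g h x)

theorem smul_connectedComponents_coe (g : G) (x : X) :
    g • (x : ConnectedComponents X) = ((g • x : X) : ConnectedComponents X) :=
  rfl

theorem mem_stabilizer_connectedComponents_coe {g : G} {x : X} :
    g ∈ MulAction.stabilizer G (x : ConnectedComponents X) ↔ g • x ∈ connectedComponent x := by
  rw [MulAction.mem_stabilizer_iff, smul_connectedComponents_coe, ConnectedComponents.coe_eq_coe']

theorem stabilizer_connectedComponents_coe_prod (x : X) (y : Y) :
    MulAction.stabilizer G ((x, y) : ConnectedComponents (X × Y)) =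
      MulAction.stabilizer G (x : ConnectedComponents X) ⊓
        MulAction.stabilizer G (y : ConnectedComponents Y) := by
  ext g
  simp only [Subgroup.mem_inf, mem_stabilizer_connectedComponents_coe, connectedComponent_prod,
    Prod.smul_mk, Set.mem_prod]

theorem isCancelSMul_connectedComponents_of_isLocallyConstant (f : X →[G] G)
    (hf : IsLocallyConstant f) : IsCancelSMul G (ConnectedComponents X) := by
  refine isCancelSMul_iff_eq_one_of_smul_eq.2 fun g =>
    ConnectedComponents.surjective_coe.forall.2 fun x hgx => ?_
  have hfgx : g • f x = f x := (map_smul f g x).symm.trans <|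
    hf.apply_eq_of_isPreconnected isPreconnected_connectedComponent
      (mem_stabilizer_connectedComponents_coe.1 hgx) mem_connectedComponent
  exact mul_eq_right.1 hfgx

theorem exists_isLocallyConstant_mulActionHom [DiscreteTopology (ConnectedComponents X)]
    [IsCancelSMul G (ConnectedComponents X)] : ∃ f : X →[G] G, IsLocallyConstant f := by
  obtain ⟨f⟩ := nonempty_mulActionHom_of_isCancelSMul (G := G) (X := ConnectedComponents X)
  exact ⟨⟨fun x => f x, fun g x => map_smul f g (x : ConnectedComponents X)⟩,
    (IsLocallyConstant.of_discrete f).comp_continuous ConnectedComponents.continuous_coe⟩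

end Components

namespace GSimplicialComplex

variable {G : Type u} [Group G] {V : Type v} [MulAction G V] {K : GSimplicialComplex G V}

theorem continuous_simplexMap (s : K.faces) : Continuous (K.simplexMap s) :=
  continuous_iff_coinduced_le.2 <|
    le_iSup (fun s : K.faces => TopologicalSpace.coinduced (K.simplexMap s) inferInstance) s

theorem isOpen_iff_simplexMap {U : Set K.Realization} :
    IsOpen U ↔ ∀ s : K.faces, IsOpen (K.simplexMap s ⁻¹' U) := by
  simp only [isOpen_iSup_iff, isOpen_coinduced]

theorem continuous_iff_simplexMap {Y : Type*} [TopologicalSpace Y] {f : K.Realization → Y} :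
    Continuous f ↔ ∀ s : K.faces, Continuous (f ∘ K.simplexMap s) :=
  continuous_iSup_dom.trans (forall_congr' fun _ => continuous_coinduced_dom)

theorem continuous_weight_simplexMap (s : K.faces) (v : V) :
    Continuous fun t => (K.simplexMap s t).weight v := by
  by_cases hv : v ∈ (s : Finset V)
  · simp only [simplexMap, dif_pos hv]
    exact (continuous_apply _).comp continuous_subtype_val
  · simp only [simplexMap, dif_neg hv]
    exact continuous_const

theorem sum_weight_eq_one (x : K.Realization) {s : Finset V} (hs : ∀ v ∉ s, x.weight v = 0) :
    ∑ v ∈ s, x.weight v = 1 := by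
  obtain ⟨t, -, ht, hsum⟩ := x.exists_face
  rw [← hsum, ← finsum_eq_sum_of_support_subset _ (Function.support_subset_iff'.2 hs),
    finsum_eq_sum_of_support_subset _ (Function.support_subset_iff'.2 ht)]

theorem continuous_of_continuous_weight {Z : Type*} [TopologicalSpace Z] {f : Z → K.Realization}
    (s : K.faces) (hs : ∀ z, ∀ v ∉ (s : Finset V), (f z).weight v = 0)
    (hf : ∀ v, Continuous fun z => (f z).weight v) : Continuous f := by
  let coords (z : Z) : stdSimplex ℝ (s : Finset V) :=
    ⟨fun v => (f z).weight v, fun v => (f z).nonneg v,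
      (Finset.sum_coe_sort _ _).trans (sum_weight_eq_one (f z) (hs z))⟩
  have hcoords : Continuous coords :=
    Continuous.subtype_mk (continuous_pi fun v : (s : Finset V) => hf v) _
  have hfactor : K.simplexMap s ∘ coords = f := by
    funext z
    ext v
    by_cases hv : v ∈ (s : Finset V)
    · exact dif_pos hv
    · exact (dif_neg hv).trans (hs z v hv).symm
  exact hfactor ▸ (continuous_simplexMap s).comp hcoords

theorem smul_weight (g : G) (x : K.Realization) (v : V) :
    (g • x).weight v = x.weight (g⁻¹ • v) :=
  rfl

instance : ContinuousConstSMul G K.Realization where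
  continuous_const_smul g := continuous_iff_simplexMap.2 fun s => by
    refine continuous_of_continuous_weight ⟨_, K.smul_mem g s s.2⟩ (fun t v hv => ?_)
      fun v => continuous_weight_simplexMap s (g⁻¹ • v)
    have hv' : g⁻¹ • v ∉ (s : Finset V) := fun h =>
      hv (Finset.mem_map.2 ⟨g⁻¹ • v, h, smul_inv_smul g v⟩)
    exact dif_neg hv'

instance : DiscreteTopology (ConnectedComponents K.Realization) := by
  refine discreteTopology_iff_forall_isOpen.2 fun U =>
    ConnectedComponents.isQuotientMap_coe.isOpen_preimage.1 <| isOpen_iff_simplexMap.2 fun s => ?_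
  have : Nonempty (s : Finset V) := (K.isRelLowerSet_faces s.2).1.to_subtype
  have hconnected : IsPreconnected (Set.range fun t =>
      (K.simplexMap s t : ConnectedComponents K.Realization)) :=
    isPreconnected_range (ConnectedComponents.continuous_coe.comp (continuous_simplexMap s))
  exact IsLocallyConstant.of_constant _
    (fun t t' => hconnected.subsingleton (Set.mem_range_self t) (Set.mem_range_self t')) U

instance [Nonempty V] : Nonempty K.Realization :=
  ‹Nonempty V›.map fun v => K.simplexMap ⟨{v}, K.singleton_mem v⟩ (Classical.arbitrary _)

theorem discreteTopology_realization (hK : ∀ s ∈ K.faces, (s : Set V).Subsingleton) :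
    DiscreteTopology K.Realization := by
  refine discreteTopology_iff_forall_isOpen.2 fun U => isOpen_iff_simplexMap.2 fun s => ?_
  have : Subsingleton (s : Finset V) := (hK s s.2).coe_sort
  have : DiscreteTopology (stdSimplex ℝ (s : Finset V)) := Subsingleton.discreteTopology
  exact isOpen_discrete _

theorem IsFree.isCancelSMul (hK : K.IsFree) : IsCancelSMul G K.Realization :=
  isCancelSMul_iff_eq_one_of_smul_eq.2 hK

end GSimplicialComplex

theorem joinComplex_isFree (G : Type u) [Group G] (k : ℕ) : (joinComplex G k).IsFree := by
  intro g x hgx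
  obtain ⟨s, hs, hsupp, hsum⟩ := x.exists_face
  obtain ⟨v, hv, hxv⟩ := Finset.exists_ne_zero_of_sum_ne_zero (hsum.trans_ne one_ne_zero)
  have hgv : g⁻¹ • v ∈ s := by
    refine not_imp_comm.1 (hsupp _) ?_
    rwa [← GSimplicialComplex.smul_weight, hgx]
  have hfix : g⁻¹ • v = v := hs.2 _ hgv v hv rfl
  exact inv_eq_one.1 (mul_eq_right.1 (congrArg JoinVertex.elt hfix))

instance (G : Type u) [Group G] : DiscreteTopology (EG G 0) :=
  GSimplicialComplex.discreteTopology_realization fun _ hs v hv w hw =>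
    hs.2 v hv w hw (Subsingleton.elim (α := Fin 1) _ _)

section MappingIndex

variable {G : Type*} [Group G] {X Y : Type*} [TopologicalSpace X] [TopologicalSpace Y]
  [MulAction G X] [MulAction G Y]

theorem mappingIndex_le_of_continuous (f : X →[G] Y) (hf : Continuous f) :
    mappingIndex G X ≤ mappingIndex G Y := by
  refine le_sInf ?_
  rintro _ ⟨k, rfl, h, hh⟩
  exact sInf_le ⟨k, rfl, h.comp f, hh.comp hf⟩

theorem mappingIndex_eq_zero_iff :
    mappingIndex G X = 0 ↔ ∃ f : X →[G] G, IsLocallyConstant f := by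
  have := (joinComplex_isFree G 0).isCancelSMul
  have : Nonempty (JoinVertex G 0) := ⟨⟨1, 0⟩⟩
  obtain ⟨toG⟩ := nonempty_mulActionHom_of_isCancelSMul (G := G) (X := EG G 0)
  obtain ⟨x₀⟩ : Nonempty (EG G 0) := inferInstance
  let orbitMap : G →[G] EG G 0 := ⟨fun g => g • x₀, fun g h => mul_smul g h x₀⟩
  rw [mappingIndex, ENat.sInf_eq_zero]
  constructor
  · rintro ⟨k, hk, f, hf⟩
    obtain rfl : 0 = k := by exact_mod_cast hk
    exact ⟨toG.comp f, (IsLocallyConstant.of_discrete toG).comp_continuous hf⟩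
  · rintro ⟨f, hf⟩
    exact ⟨0, rfl, orbitMap.comp f, (hf.comp orbitMap).continuous⟩

variable [ContinuousConstSMul G X] [ContinuousConstSMul G Y]

theorem mappingIndex_eq_zero_iff_isCancelSMul [DiscreteTopology (ConnectedComponents X)] :
    mappingIndex G X = 0 ↔ IsCancelSMul G (ConnectedComponents X) := by
  rw [mappingIndex_eq_zero_iff]
  exact ⟨fun ⟨f, hf⟩ => isCancelSMul_connectedComponents_of_isLocallyConstant f hf,
    fun _ => exists_isLocallyConstant_mulActionHom⟩

theorem exists_stabilizer_ne_bot_of_mappingIndex_ne_zero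
    [DiscreteTopology (ConnectedComponents X)] (hX : mappingIndex G X ≠ 0) :
    ∃ x : X, MulAction.stabilizer G (x : ConnectedComponents X) ≠ ⊥ := by
  rw [Ne, mappingIndex_eq_zero_iff_isCancelSMul, isCancelSMul_iff_stabilizer_eq_bot,
    ConnectedComponents.surjective_coe.forall] at hX
  exact not_forall.1 hX

variable [DiscreteTopology (ConnectedComponents X)] [DiscreteTopology (ConnectedComponents Y)]

theorem mappingIndex_prod_ne_zero
    (hG : ∀ H K : Subgroup G, Disjoint H K → H = ⊥ ∨ K = ⊥)
    (hX : mappingIndex G X ≠ 0) (hY : mappingIndex G Y ≠ 0) : mappingIndex G (X × Y) ≠ 0 := by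
  obtain ⟨x, hx⟩ := exists_stabilizer_ne_bot_of_mappingIndex_ne_zero hX
  obtain ⟨y, hy⟩ := exists_stabilizer_ne_bot_of_mappingIndex_ne_zero hY
  intro hXY
  obtain ⟨f, hf⟩ := mappingIndex_eq_zero_iff.1 hXY
  have := isCancelSMul_connectedComponents_of_isLocallyConstant f hf
  have hdisjoint : Disjoint (MulAction.stabilizer G (x : ConnectedComponents X))
      (MulAction.stabilizer G (y : ConnectedComponents Y)) := by
    rw [disjoint_iff, ← stabilizer_connectedComponents_coe_prod, IsCancelSMul.stabilizer_eq_bot]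
  exact (hG _ _ hdisjoint).elim hx hy

end MappingIndex

theorem theorem2_general {G X Y : Type*} [Group G] [TopologicalSpace X] [TopologicalSpace Y]
    [MulAction G X] [MulAction G Y] [ContinuousConstSMul G X] [ContinuousConstSMul G Y]
    [DiscreteTopology (ConnectedComponents X)] [DiscreteTopology (ConnectedComponents Y)]
    (hG : ∀ H K : Subgroup G, Disjoint H K → H = ⊥ ∨ K = ⊥)
    (hX : mappingIndex G X = 1) (hY : mappingIndex G Y = 1) : mappingIndex G (X × Y) = 1 := by
  refine le_antisymm ?_ (Order.one_le_iff_ne_zero.2 ?_)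
  · exact (mappingIndex_le_of_continuous (MulActionHom.fst G X Y) continuous_fst).trans hX.le
  · exact mappingIndex_prod_ne_zero hG (hX.trans_ne one_ne_zero) (hY.trans_ne one_ne_zero)

theorem theorem2 {G : Type u} [Group G] (hG : IsNiceGroup G) :
    (∀ (V₁ : Type v) (V₂ : Type w) [MulAction G V₁] [MulAction G V₂]
      (K₁ : GSimplicialComplex G V₁) (K₂ : GSimplicialComplex G V₂),
      K₁.IsFree → K₂.IsFree →
      mappingIndex G K₁.Realization = 1 → mappingIndex G K₂.Realization = 1 →
      mappingIndex G (K₁.Realization × K₂.Realization) = 1) ∧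
    HCT.{u, v, w} G 1 :=
  ⟨fun _ _ _ _ _ _ _ _ => theorem2_general fun _ _ => hG.eq_bot_or_eq_bot_of_disjoint,
    fun _ _ _ _ _ _ _ _ _ _ => theorem2_general fun _ _ => hG.eq_bot_or_eq_bot_of_disjoint⟩
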